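/- For a graph $F$, a hypergraph $\mathcal H$ (without repeated edges) is a Berge-$F$ if the vertices of $F$ can be embedded injectively into the vertex set of $\mathcal H$ in such a way that there is a bijection $\phi:E(F)\to E(\mathcal H)$ with $e\subseteq\phi(e)$ for every $e\in E(F)$. A $k$-uniform hypergraph $\mathcal H$ is Berge-$F$-saturated if no subhypergraph of $\mathcal H$ is a Berge-$F$, but for every $k$-element set $e$ of vertices of $\mathcal H$ that is not an edge, $\mathcal H+e$ has a subhypergraph that is a Berge-$F$. Let $\mathrm{sat}_k(n,\text{Berge-}F)$ be the least number of edges in a Berge-$F$-saturated $k$-uniform hypergraph on $n$ vertices. Theorem. For all fixed integers $\ell\ge 3$ and $k\ge 3$, $$\mathrm{sat}_k(n,\text{Berge-}K_\ell)\sim\frac{\ell-2}{k-1}\,n\qquad\text{as } n\to\infty,$$ that is, the ratio of the two sides tends to $1$. -/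

import Mathlib

namespace Hypergraph

/-- `H` is `k`-uniform: every edge has exactly `k` vertices. -/
def IsUniform {α : Type*} (H : Hypergraph α) (k : ℕ) : Prop :=
  ∀ e ∈ H.edgeSet, e.encard = k

/-- `H'` is a subhypergraph of `H`. -/
def IsSubhypergraph {α : Type*} (H' H : Hypergraph α) : Prop :=
  H'.vertexSet ⊆ H.vertexSet ∧ H'.edgeSet ⊆ H.edgeSet

/-- `H` is a Berge-`F`: the vertices of `F` can be embedded into the vertices of `H` by some `f` in
such a way that there is a bijection `φ` from the edges of `F` to the edges of `H` for which each
edge `e` of `F`, seen inside `H` through `f`, is contained in `φ e`. -/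
def IsBerge {α W : Type*} (F : SimpleGraph W) (H : Hypergraph α) : Prop :=
  ∃ f : W ↪ α, (∀ w, f w ∈ H.vertexSet) ∧
    ∃ φ : F.edgeSet ≃ H.edgeSet,
      ∀ e : F.edgeSet, ∀ w ∈ (e : Sym2 W), f w ∈ (φ e : Set α)

/-- `H` contains a Berge-`F`. -/
def ContainsBerge {α W : Type*} (F : SimpleGraph W) (H : Hypergraph α) : Prop :=
  ∃ H' : Hypergraph α, H'.IsSubhypergraph H ∧ IsBerge F H'

/-- The hypergraph `H + e`, where `e` is a set of vertices of `H`. -/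
def addEdge {α : Type*} (H : Hypergraph α) (e : Set α) (he : e ⊆ H.vertexSet) :
    Hypergraph α where
  vertexSet := H.vertexSet
  edgeSet := insert e H.edgeSet
  subset_vertexSet_of_mem_edgeSet' := by
    intro e' he'
    rcases Set.mem_insert_iff.mp he' with rfl | h
    · exact he
    · exact H.subset_vertexSet_of_mem_edgeSet' h

/-- `H` is a Berge-`F`-saturated `k`-uniform hypergraph: it is `k`-uniform, it contains no
Berge-`F`, and adding any missing `k`-set of vertices as an edge creates a Berge-`F`. -/
def IsBergeSaturated {α W : Type*} (F : SimpleGraph W) (k : ℕ) (H : Hypergraph α) : Prop :=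
  H.IsUniform k ∧ ¬ ContainsBerge F H ∧
    ∀ (e : Set α) (he : e ⊆ H.vertexSet), e.encard = k → e ∉ H.edgeSet →
      ContainsBerge F (H.addEdge e he)

/-- `sat_k(n, Berge-F)`: the least number of edges in a Berge-`F`-saturated `k`-uniform hypergraph
on `n` vertices. -/
noncomputable def bergeSat {W : Type*} (k n : ℕ) (F : SimpleGraph W) : ℕ :=
  sInf {m : ℕ | ∃ H : Hypergraph (Fin n), H.vertexSet = Set.univ ∧
    IsBergeSaturated F k H ∧ H.edgeSet.ncard = m}

end Hypergraph

/-!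
Write `ℓ = m + 2`.

*Lower bound.* In a saturated hypergraph with `O(n)` edges, only few vertices have degree above a
large constant `D`; call them high. Take `k` low vertices which are pairwise neither adjacent nor
joined through a third low vertex. They do not form an edge, and adding them creates a Berge-`K_ℓ`
in which the new edge joins two of them, `u` and `v`. The other `m` core vertices are common
neighbours of `u` and `v` (`exists_common_neighbours`), hence high, so that `u` lies in `m` edges
meeting the high vertices. As neighbourhoods of low vertices are bounded, this holds for all but a
bounded number of low vertices `u`. An edge meeting the high vertices has at most `k - 1` low
vertices, and double counting gives `m n ≤ (k - 1) |E| + o(n)` (`card_mul_le_of_saturated`).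

*Upper bound.* Take vertices `w 0, …, w (m - 1)` and `z`, cut the remaining ones into blocks of size
`k - 1`, and take all edges `A ∪ {w i}` with `A` a block, about `m n / (k - 1)` in number. A bounded
number of further edges turns the `w i`, `z` and a vertex `z'` of a fixed block `A₀` into a
Berge-`K_ℓ` lacking one edge only. There is no Berge-`K_ℓ`, since vertices in one ordinary block
have degree `m` and too few edges are left (`BlockFrame.not_hasBergeClique`). On the other hand, let `e`
be a new edge through a vertex `u` of an ordinary block (`BlockFrame.hasBergeClique_insert`).
If `e` contains `z` or a vertex `v` of another block, then `u`, that vertex and all `w i` form the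
core of a Berge-`K_ℓ`. If not, `e` contains two of the `w i`, and it supplies the edge that was
lacking, after an exchange along the edges containing `w i`, `w j`, `z` and `w i`, `z`, `z'`
(`BlockFrame.hasBergeClique_insert_of_core`). So a maximal Berge-`K_ℓ`-free extension has new edges
only inside a set of bounded size. When `k - 1` does not divide the number of vertices to be
covered, the last two blocks overlap.
-/

namespace Hypergraph

/-! ### Berge cliques as families of distinct edges -/

/-- The set `E` of edges contains a Berge-`K_ℓ`: there are `ℓ` distinct core vertices `f i` and,
for each pair of them, an edge `φ s(i, j)` of `E` containing both, distinct pairs having distinct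
edges. The values of `φ` on the diagonal are irrelevant. -/
def HasBergeClique {α : Type*} (ℓ : ℕ) (E : Set (Set α)) : Prop :=
  ∃ f : Fin ℓ → α, Function.Injective f ∧ ∃ φ : Sym2 (Fin ℓ) → Set α,
    (∀ i j, i ≠ j → φ s(i, j) ∈ E ∧ f i ∈ φ s(i, j)) ∧
    ∀ s t, ¬ s.IsDiag → ¬ t.IsDiag → φ s = φ t → s = t

theorem HasBergeClique.mono {α : Type*} {ℓ : ℕ} {E E' : Set (Set α)} (h : HasBergeClique ℓ E)
    (hE : E ⊆ E') : HasBergeClique ℓ E' := by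
  obtain ⟨f, hf, φ, hφ, hinj⟩ := h
  exact ⟨f, hf, φ, fun i j hij => ⟨hE (hφ i j hij).1, (hφ i j hij).2⟩, hinj⟩

theorem mem_edgeSet_completeGraph {V : Type*} (s : Sym2 V) :
    s ∈ (SimpleGraph.completeGraph V).edgeSet ↔ ¬ s.IsDiag := by
  induction s with
  | _ a b => simp [SimpleGraph.completeGraph]

theorem containsBerge_completeGraph_iff {α : Type*} {ℓ : ℕ} {H : Hypergraph α}
    (hV : H.vertexSet = Set.univ) :
    ContainsBerge (SimpleGraph.completeGraph (Fin ℓ)) H ↔ HasBergeClique ℓ H.edgeSet := by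
  classical
  constructor
  · rintro ⟨H', ⟨-, hE⟩, f, -, φ, hφ⟩
    refine ⟨f, f.injective, fun s => if h : s ∈ (SimpleGraph.completeGraph (Fin ℓ)).edgeSet then
      (φ ⟨s, h⟩ : Set α) else ∅, fun i j hij => ?_, fun s t hs ht hst => ?_⟩
    · have h : s(i, j) ∈ (SimpleGraph.completeGraph (Fin ℓ)).edgeSet := by
        rw [mem_edgeSet_completeGraph]; simpa using hij
      simp only [h, dif_pos]
      exact ⟨hE (φ ⟨_, h⟩).2, hφ ⟨_, h⟩ i (by simp)⟩
    · rw [← mem_edgeSet_completeGraph] at hs ht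
      simp only [hs, ht, dif_pos] at hst
      have := φ.injective (Subtype.ext hst)
      simpa using this
  · rintro ⟨f, hf, φ, hφ, hinj⟩
    let g : (SimpleGraph.completeGraph (Fin ℓ)).edgeSet → Set α := fun s => φ s
    have hg : Function.Injective g := fun s t hst => Subtype.ext
      (hinj _ _ ((mem_edgeSet_completeGraph _).1 s.2) ((mem_edgeSet_completeGraph _).1 t.2) hst)
    refine ⟨⟨Set.univ, Set.range g, fun _ _ => Set.subset_univ _⟩, ⟨by simp [hV], ?_⟩,
      ⟨f, hf⟩, fun _ => Set.mem_univ _, Equiv.ofInjective g hg, ?_⟩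
    · rintro _ ⟨⟨s, hs⟩, rfl⟩
      rw [mem_edgeSet_completeGraph] at hs
      induction s with
      | _ a b => exact (hφ a b (by simpa using hs)).1
    · rintro ⟨s, hs⟩ w hw
      rw [mem_edgeSet_completeGraph] at hs
      induction s with
      | _ a b =>
        have hab : a ≠ b := by simpa using hs
        simp only [Sym2.mem_iff] at hw
        change f w ∈ φ s(a, b)
        rcases hw with rfl | rfl
        · exact (hφ _ _ hab).2
        · rw [Sym2.eq_swap]; exact (hφ _ _ hab.symm).2

/-- It suffices to choose the edge of each pair `i < j`. -/
theorem HasBergeClique.of_lt {α : Type*} {ℓ : ℕ} {E : Set (Set α)} {f : Fin ℓ → α}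
    (hf : Function.Injective f) (φ : Fin ℓ → Fin ℓ → Set α)
    (hφ : ∀ i j, i < j → φ i j ∈ E ∧ f i ∈ φ i j ∧ f j ∈ φ i j)
    (hinj : ∀ i j i' j', i < j → i' < j' → φ i j = φ i' j' → i = i' ∧ j = j') :
    HasBergeClique ℓ E := by
  refine ⟨f, hf, fun s => φ s.inf s.sup, fun i j hij => ?_, fun s t hs ht hst => ?_⟩
  · rcases lt_or_gt_of_ne hij with h | h
    · simp only [Sym2.inf_mk, Sym2.sup_mk, inf_eq_left.2 h.le, sup_eq_right.2 h.le]
      exact ⟨(hφ _ _ h).1, (hφ _ _ h).2.1⟩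
    · simp only [Sym2.inf_mk, Sym2.sup_mk, inf_eq_right.2 h.le, sup_eq_left.2 h.le]
      exact ⟨(hφ _ _ h).1, (hφ _ _ h).2.2⟩
  · have key : ∀ s : Sym2 (Fin ℓ), ¬ s.IsDiag → s.inf < s.sup := by
      intro s hs
      induction s with
      | _ a b => simpa [eq_comm] using hs
    exact Sym2.inf_eq_inf_and_sup_eq_sup.1 (hinj _ _ _ _ (key s hs) (key t ht) hst)

/-- A Berge-`K_{m+2}` with core `u, v, w 0, …, w (m - 1)`, assembled from an edge `e` for `uv`,
edges `a i` for `u (w i)`, edges `b i` for `v (w i)` and edges `c i j` for `(w i) (w j)`. -/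
theorem HasBergeClique.of_cone {α : Type*} {m : ℕ} {E : Set (Set α)} {u v : α} {w : Fin m → α}
    (hw : Function.Injective w) (huv : u ≠ v) (hu : ∀ i, w i ≠ u) (hv : ∀ i, w i ≠ v)
    {e : Set α} {a b : Fin m → Set α} {c : Fin m → Fin m → Set α}
    (he : e ∈ E ∧ u ∈ e ∧ v ∈ e)
    (ha : ∀ i, a i ∈ E ∧ u ∈ a i ∧ w i ∈ a i)
    (hb : ∀ i, b i ∈ E ∧ v ∈ b i ∧ w i ∈ b i)
    (hc : ∀ i j, i < j → c i j ∈ E ∧ w i ∈ c i j ∧ w j ∈ c i j)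
    (hai : Function.Injective a) (hbi : Function.Injective b)
    (hci : ∀ i j i' j', i < j → i' < j' → c i j = c i' j' → i = i' ∧ j = j')
    (hea : ∀ i, e ≠ a i) (heb : ∀ i, e ≠ b i) (hec : ∀ i j, i < j → e ≠ c i j)
    (hab : ∀ i j, a i ≠ b j) (hac : ∀ i i' j', i' < j' → a i ≠ c i' j')
    (hbc : ∀ i i' j', i' < j' → b i ≠ c i' j') :
    HasBergeClique (m + 2) E := by
  let f : Fin (m + 2) → α := Fin.cons u (Fin.cons v w)
  let φ : Fin (m + 2) → Fin (m + 2) → Set α := fun i j =>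
    Fin.cases (Fin.cases ∅ (fun j => Fin.cases e a j) j)
      (fun i => Fin.cases ∅ (fun j =>
        Fin.cases ∅ (fun j => Fin.cases (b j) (fun i => c i j) i) j) j) i
  refine HasBergeClique.of_lt (f := f) ?_ φ ?_ ?_
  · refine Fin.cons_injective_iff.2 ⟨?_, Fin.cons_injective_iff.2 ⟨?_, hw⟩⟩
    · rintro ⟨i, hi⟩
      induction i using Fin.cases with
      | zero => exact huv hi.symm
      | succ i => exact hu i hi
    · rintro ⟨i, hi⟩
      exact hv i hi
  · intro i j hij
    induction i using Fin.cases with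
    | zero =>
      induction j using Fin.cases with
      | zero => exact absurd hij (lt_irrefl _)
      | succ j =>
        induction j using Fin.cases with
        | zero => exact he
        | succ j => exact ha j
    | succ i =>
      induction j using Fin.cases with
      | zero => exact absurd hij (Fin.not_lt_zero _)
      | succ j =>
        rw [Fin.succ_lt_succ_iff] at hij
        induction j using Fin.cases with
        | zero => exact absurd hij (Fin.not_lt_zero _)
        | succ j =>
          induction i using Fin.cases with
          | zero => exact hb j
          | succ i => exact hc i j (Fin.succ_lt_succ_iff.1 hij)
  · have key : ∀ i j : Fin (m + 2), i < j →
        (i = 0 ∧ j = (0 : Fin (m + 1)).succ ∧ φ i j = e) ∨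
        (∃ x : Fin m, i = 0 ∧ j = x.succ.succ ∧ φ i j = a x) ∨
        (∃ x : Fin m, i = (0 : Fin (m + 1)).succ ∧ j = x.succ.succ ∧ φ i j = b x) ∨
        (∃ x y : Fin m, x < y ∧ i = x.succ.succ ∧ j = y.succ.succ ∧ φ i j = c x y) := by
      intro i j hij
      induction i using Fin.cases with
      | zero =>
        induction j using Fin.cases with
        | zero => exact absurd hij (lt_irrefl _)
        | succ j =>
          induction j using Fin.cases with
          | zero => exact Or.inl ⟨rfl, rfl, rfl⟩
          | succ j => exact Or.inr (Or.inl ⟨j, rfl, rfl, rfl⟩)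
      | succ i =>
        induction j using Fin.cases with
        | zero => exact absurd hij (Fin.not_lt_zero _)
        | succ j =>
          rw [Fin.succ_lt_succ_iff] at hij
          induction j using Fin.cases with
          | zero => exact absurd hij (Fin.not_lt_zero _)
          | succ j =>
            induction i using Fin.cases with
            | zero => exact Or.inr (Or.inr (Or.inl ⟨j, rfl, rfl, rfl⟩))
            | succ i =>
              exact Or.inr (Or.inr (Or.inr ⟨i, j, Fin.succ_lt_succ_iff.1 hij, rfl, rfl, rfl⟩))
    intro i j i' j' hij hij' h
    rcases key i j hij with ⟨rfl, rfl, h1⟩ | ⟨x, rfl, rfl, h1⟩ | ⟨x, rfl, rfl, h1⟩ |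
      ⟨x, y, hxy, rfl, rfl, h1⟩ <;>
    rcases key i' j' hij' with ⟨rfl, rfl, h2⟩ | ⟨x', rfl, rfl, h2⟩ | ⟨x', rfl, rfl, h2⟩ |
      ⟨x', y', hxy', rfl, rfl, h2⟩ <;>
    replace h := h1.symm.trans (h.trans h2)
    · exact ⟨rfl, rfl⟩
    · exact absurd h (hea _)
    · exact absurd h (heb _)
    · exact absurd h (hec _ _ hxy')
    · exact absurd h.symm (hea _)
    · rw [hai h]; exact ⟨rfl, rfl⟩
    · exact absurd h (hab _ _)
    · exact absurd h (hac _ _ _ hxy')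
    · exact absurd h.symm (heb _)
    · exact absurd h.symm (hab _ _)
    · rw [hbi h]; exact ⟨rfl, rfl⟩
    · exact absurd h (hbc _ _ _ hxy')
    · exact absurd h.symm (hec _ _ hxy)
    · exact absurd h.symm (hac _ _ _ hxy)
    · exact absurd h.symm (hbc _ _ _ hxy)
    · obtain ⟨rfl, rfl⟩ := hci _ _ _ _ hxy hxy' h
      exact ⟨rfl, rfl⟩

/-! ### The lower bound -/

/-- Greedy choice of `j` elements that are pairwise unrelated, in a finite set in which each element
is related to few others. -/
theorem exists_pairwise_not_rel {α : Type*} [DecidableEq α] (B : Finset α) (r : α → α → Prop)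
    [DecidableRel r] (hr : ∀ u v, r u v → r v u) (M : ℕ)
    (hM : ∀ u ∈ B, (B.filter fun v => u = v ∨ r u v).card ≤ M) (j : ℕ) (hj : j * M < B.card) :
    ∃ I ⊆ B, I.card = j ∧ ∀ u ∈ I, ∀ v ∈ I, u ≠ v → ¬ r u v := by
  induction j with
  | zero => exact ⟨∅, by simp, rfl, by simp⟩
  | succ j ih =>
    obtain ⟨I, hIB, hIc, hI⟩ := ih (lt_of_le_of_lt (Nat.mul_le_mul_right _ (Nat.le_succ j)) hj)
    have hcard : (I.biUnion fun u => B.filter fun v => u = v ∨ r u v).card < B.card := by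
      refine lt_of_le_of_lt (Finset.card_biUnion_le_card_mul _ _ M fun u hu => hM u (hIB hu)) ?_
      rw [hIc]
      exact lt_of_le_of_lt (Nat.mul_le_mul_right _ (Nat.le_succ j)) hj
    obtain ⟨x, hxB, hx⟩ := Finset.exists_mem_notMem_of_card_lt_card hcard
    have hx' : ∀ u ∈ I, u ≠ x ∧ ¬ r u x := by
      intro u hu
      by_contra hcon
      exact hx (Finset.mem_biUnion.2 ⟨u, hu, Finset.mem_filter.2 ⟨hxB, by tauto⟩⟩)
    refine ⟨insert x I, Finset.insert_subset hxB hIB, ?_, ?_⟩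
    · rw [Finset.card_insert_of_notMem (fun h => (hx' x h).1 rfl), hIc]
    · intro u hu v hv huv
      rcases Finset.mem_insert.1 hu with rfl | hu' <;> rcases Finset.mem_insert.1 hv with rfl | hv'
      · exact absurd rfl huv
      · exact fun h => (hx' v hv').2 (hr _ _ h)
      · exact (hx' u hu').2
      · exact hI u hu' v hv' huv

/-- Suppose that every `k`-set outside `E` contains two vertices `u ≠ v` with at least `m` common
neighbours, joined to `u` by distinct edges. Call a vertex high if its degree exceeds `D`; there are
at most `k |E| / D` high vertices. All but a bounded number of the others lie in at least `m` edges
meeting the high vertices, since among too many exceptions there are `k` which are pairwise far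
apart. An edge meeting the high vertices has at most `k - 1` other vertices. -/
theorem card_mul_le_of_saturated {α : Type*} [Fintype α] (E : Finset (Set α)) (k m : ℕ)
    (hk : 2 ≤ k) (hE : ∀ e ∈ E, e.ncard = k)
    (hsat : ∀ e : Set α, e.ncard = k → e ∉ E → ∃ u ∈ e, ∃ v ∈ e, u ≠ v ∧
      ∃ X : Finset α, m ≤ X.card ∧ ∃ a : α → Set α, Set.InjOn a X ∧
        ∀ x ∈ X, a x ∈ E ∧ u ∈ a x ∧ x ∈ a x ∧ ∃ g ∈ E, v ∈ g ∧ x ∈ g) (D : ℕ) :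
    ∃ h : ℕ, D * h ≤ k * E.card ∧
      m * Fintype.card α ≤
        (k - 1) * E.card + m * (h + k * (1 + D * k + D * k * (D * k))) := by
  classical
  have hE' : ∀ e ∈ E, e.toFinset.card = k := fun e he => by
    rw [← hE e he, Set.ncard_eq_toFinset_card']
  let deg : α → ℕ := fun u => (E.filter fun e => u ∈ e).card
  let Hi : Finset α := Finset.univ.filter fun u => D < deg u
  let N : α → Finset α := fun u => (E.filter fun e => u ∈ e).biUnion fun e => e.toFinset
  have hN : ∀ u v, v ∈ N u ↔ ∃ e ∈ E, u ∈ e ∧ v ∈ e := fun u v => by simp [N, and_assoc]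
  have hNc : ∀ u ∉ Hi, (N u).card ≤ D * k := by
    intro u hu
    have hu' : deg u ≤ D := by simpa [Hi] using hu
    refine (Finset.card_biUnion_le_card_mul _ _ k fun e he => ?_).trans
      (Nat.mul_le_mul_right _ hu')
    exact (hE' e (Finset.mem_filter.1 he).1).le
  let r : α → α → Prop := fun u v => v ∈ N u ∨ ∃ w, w ∉ Hi ∧ w ∈ N u ∧ v ∈ N w
  have hNs : ∀ u v, v ∈ N u → u ∈ N v := fun u v h => by
    rw [hN] at h ⊢
    obtain ⟨e, he, h1, h2⟩ := h
    exact ⟨e, he, h2, h1⟩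
  have hrs : ∀ u v, r u v → r v u := by
    rintro u v (h | ⟨w, h1, h2, h3⟩)
    · exact Or.inl (hNs _ _ h)
    · exact Or.inr ⟨w, h1, hNs _ _ h3, hNs _ _ h2⟩
  let E₁ : Finset (Set α) := E.filter fun e => ∃ h ∈ Hi, h ∈ e
  let B : Finset α :=
    Finset.univ.filter fun u => u ∉ Hi ∧ (E₁.filter fun e => u ∈ e).card < m
  have hB : B.card ≤ k * (1 + D * k + D * k * (D * k)) := by
    by_contra! hcon
    have hclose : ∀ u ∈ B, (B.filter fun v => u = v ∨ r u v).card ≤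
        1 + D * k + D * k * (D * k) := by
      intro u hu
      have hu' : u ∉ Hi := (Finset.mem_filter.1 hu).2.1
      have hsub : (B.filter fun v => u = v ∨ r u v) ⊆
          ({u} ∪ N u) ∪ ((N u).filter fun w => w ∉ Hi).biUnion N := by
        intro v hv
        simp only [Finset.mem_filter] at hv
        simp only [Finset.mem_union, Finset.mem_singleton, Finset.mem_biUnion, Finset.mem_filter]
        rcases hv.2 with rfl | h | ⟨w, h1, h2, h3⟩
        · exact Or.inl (Or.inl rfl)
        · exact Or.inl (Or.inr h)
        · exact Or.inr ⟨w, ⟨h2, h1⟩, h3⟩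
      refine (Finset.card_le_card hsub).trans ((Finset.card_union_le _ _).trans
        (add_le_add ((Finset.card_union_le _ _).trans (add_le_add (by simp) (hNc u hu'))) ?_))
      refine (Finset.card_biUnion_le_card_mul _ _ (D * k) fun w hw =>
        hNc w (Finset.mem_filter.1 hw).2).trans (Nat.mul_le_mul_right _ ?_)
      exact (Finset.card_le_card (Finset.filter_subset _ _)).trans (hNc u hu')
    obtain ⟨I, hIB, hIc, hI⟩ := exists_pairwise_not_rel B r hrs _ hclose k hcon
    have hIE : (I : Set α) ∉ E := by
      intro hIE
      obtain ⟨x, hx, y, hy, hxy⟩ := Finset.one_lt_card.1 (show 1 < I.card by omega)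
      exact hI x hx y hy hxy (Or.inl ((hN x y).2 ⟨_, hIE, hx, hy⟩))
    obtain ⟨u, hu, v, hv, huv, X, hX, a, hai, ha⟩ := hsat I (by simpa using hIc) hIE
    have huB := (Finset.mem_filter.1 (hIB hu)).2.2
    refine absurd (hX.trans (Finset.card_le_card_of_injOn a (fun x hx => ?_) hai)) (not_le.2 huB)
    obtain ⟨h1, h2, h3, g, hg, h4, h5⟩ := ha x hx
    have hxHi : x ∈ Hi := by
      by_contra hlow
      exact hI u hu v hv huv (Or.inr ⟨x, hlow, (hN _ _).2 ⟨_, h1, h2, h3⟩,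
        (hN _ _).2 ⟨g, hg, h5, h4⟩⟩)
    simp only [Finset.coe_filter, Set.mem_ofPred_eq, E₁, Finset.mem_filter]
    exact ⟨⟨h1, x, hxHi, h3⟩, h2⟩
  refine ⟨Hi.card, ?_, ?_⟩
  · have h1 : ∑ u ∈ Hi, D ≤ ∑ u, deg u :=
      (Finset.sum_le_sum fun u hu => (Finset.mem_filter.1 hu).2.le).trans
        (Finset.sum_le_sum_of_subset (Finset.subset_univ _))
    have h2 : ∑ u, deg u = ∑ e ∈ E, (Finset.univ.filter fun u => u ∈ e).card :=
      Finset.sum_card_bipartiteAbove_eq_sum_card_bipartiteBelow (fun u e => u ∈ e)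
    have h3 : ∑ e ∈ E, (Finset.univ.filter fun u => u ∈ e).card = ∑ e ∈ E, k :=
      Finset.sum_congr rfl fun e he => by
        rw [← hE' e he]; congr 1; ext; simp
    rw [h2, h3] at h1
    simp only [Finset.sum_const, smul_eq_mul] at h1
    linarith
  · let G : Finset α := Finset.univ.filter fun u => u ∉ Hi ∧ u ∉ B
    have hcover : Fintype.card α ≤ G.card + (Hi.card + B.card) := by
      rw [← Finset.card_univ]
      refine (Finset.card_le_card (t := G ∪ (Hi ∪ B)) fun u _ => ?_).trans
        ((Finset.card_union_le _ _).trans (Nat.add_le_add_left (Finset.card_union_le _ _) _))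
      simp only [Finset.mem_union, G, Finset.mem_filter, Finset.mem_univ, true_and]
      tauto
    have h1 : ∑ u ∈ G, m ≤ ∑ u ∈ G, (E₁.filter fun e => u ∈ e).card := by
      refine Finset.sum_le_sum fun u hu => ?_
      have hu' := (Finset.mem_filter.1 hu).2
      by_contra! hlt
      exact hu'.2 (Finset.mem_filter.2 ⟨Finset.mem_univ _, hu'.1, hlt⟩)
    have h2 : ∑ u ∈ G, (E₁.filter fun e => u ∈ e).card =
        ∑ e ∈ E₁, (G.filter fun u => u ∈ e).card :=
      Finset.sum_card_bipartiteAbove_eq_sum_card_bipartiteBelow (fun u e => u ∈ e)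
    have h3 : ∑ e ∈ E₁, (G.filter fun u => u ∈ e).card ≤ ∑ e ∈ E₁, (k - 1) := by
      refine Finset.sum_le_sum fun e he => ?_
      obtain ⟨heE, h, hh, hhe⟩ := Finset.mem_filter.1 he
      rw [← hE' e heE, ← Finset.card_erase_of_mem (Set.mem_toFinset.2 hhe)]
      refine Finset.card_le_card fun u hu => ?_
      obtain ⟨huG, hue⟩ := Finset.mem_filter.1 hu
      refine Finset.mem_erase.2 ⟨?_, Set.mem_toFinset.2 hue⟩
      rintro rfl
      exact (Finset.mem_filter.1 huG).2.1 hh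
    have h4 : E₁.card ≤ E.card := Finset.card_le_card (Finset.filter_subset _ _)
    have h5 : m * G.card ≤ (k - 1) * E.card := by
      have := h1.trans (h2.le.trans h3)
      simp only [Finset.sum_const, smul_eq_mul] at this
      nlinarith [Nat.mul_le_mul_right (k - 1) h4]
    calc m * Fintype.card α ≤ m * (G.card + (Hi.card + B.card)) := Nat.mul_le_mul_left _ hcover
      _ = m * G.card + m * (Hi.card + B.card) := by ring
      _ ≤ _ := add_le_add h5 (Nat.mul_le_mul_left _ (Nat.add_le_add_left hB _))

/-- In a Berge-`K_{m+2}`-saturated hypergraph, the new Berge clique that appears when `e` is added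
uses `e` for a pair `u, v` of core vertices, and the other `m` core vertices are common neighbours
of `u` and `v`. -/
theorem exists_common_neighbours {α : Type*} {m : ℕ} {E : Set (Set α)} {e : Set α}
    (hfree : ¬ HasBergeClique (m + 2) E) (h : HasBergeClique (m + 2) (insert e E)) :
    ∃ u ∈ e, ∃ v ∈ e, u ≠ v ∧ ∃ X : Finset α, m ≤ X.card ∧ ∃ a : α → Set α, Set.InjOn a X ∧
        ∀ x ∈ X, a x ∈ E ∧ u ∈ a x ∧ x ∈ a x ∧ ∃ g ∈ E, v ∈ g ∧ x ∈ g := by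
  classical
  obtain ⟨f, hf, φ, hφ, hinj⟩ := h
  have hφ' : ∀ i j, i ≠ j → f j ∈ φ s(i, j) := fun i j hij => by
    rw [Sym2.eq_swap]; exact (hφ j i hij.symm).2
  obtain ⟨p, q, hpq, hφe⟩ : ∃ p q, p ≠ q ∧ φ s(p, q) = e := by
    by_contra! hcon
    exact hfree ⟨f, hf, φ, fun i j hij =>
      ⟨((hφ i j hij).1).resolve_left (hcon i j hij), (hφ i j hij).2⟩, hinj⟩
  have hE : ∀ i j, i ≠ j → s(i, j) ≠ s(p, q) → φ s(i, j) ∈ E := by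
    intro i j hij hne
    refine ((hφ i j hij).1).resolve_left fun h => hne ?_
    exact hinj _ _ (by simpa using hij) (by simpa using hpq) (h.trans hφe.symm)
  let Y : Finset (Fin (m + 2)) := Finset.univ \ {p, q}
  have hY : ∀ i ∈ Y, i ≠ p ∧ i ≠ q := fun i hi => by simpa [Y] using hi
  refine ⟨f p, hφe ▸ (hφ p q hpq).2, f q, hφe ▸ hφ' p q hpq, hf.ne hpq, Y.image f, ?_,
    fun x => φ s(p, Function.invFun f x), ?_, ?_⟩
  · rw [Finset.card_image_of_injective _ hf, Finset.card_sdiff, Finset.inter_univ,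
      Finset.card_univ, Fintype.card_fin, Finset.card_pair hpq]
    omega
  · intro x hx y hy hxy
    simp only [Finset.coe_image, Set.mem_image, Finset.mem_coe] at hx hy
    obtain ⟨i, hi, rfl⟩ := hx
    obtain ⟨j, hj, rfl⟩ := hy
    simp only [Function.leftInverse_invFun hf _] at hxy
    have := hinj _ _ (by simpa using (hY i hi).1.symm) (by simpa using (hY j hj).1.symm) hxy
    rw [Sym2.congr_right.1 this]
  · intro x hx
    obtain ⟨i, hi, rfl⟩ := Finset.mem_image.1 hx
    obtain ⟨h1, h2⟩ := hY i hi
    simp only [Function.leftInverse_invFun hf _]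
    refine ⟨hE _ _ h1.symm ?_, (hφ _ _ h1.symm).2, hφ' _ _ h1.symm, φ s(q, i), hE _ _ h2.symm ?_,
      (hφ _ _ h2.symm).2, hφ' _ _ h2.symm⟩
    · simp only [ne_eq, Sym2.eq_iff]; tauto
    · simp only [ne_eq, Sym2.eq_iff]; tauto

/-! ### A sparse hypergraph that is almost saturated -/

/-- The vertex partition behind the construction: vertices `w i` and `z`, and the remaining vertices
covered by a family of blocks of size `k - 1`. Two different blocks are disjoint, except that `A₁`
and `A₂` may overlap (they may also be the same block), which leaves the number of vertices
arbitrary modulo `k - 1`. The block `A₀` carries a vertex `z'` and a set `F` used to fill up edges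
to size `k`. -/
structure BlockFrame (α : Type*) (m k : ℕ) where
  /-- the vertices joined to every block -/
  w : Fin m → α
  /-- a vertex outside all blocks, joined to every `w i` -/
  z : α
  /-- a vertex of `A₀`, joined to `z` -/
  z' : α
  /-- the filling set -/
  F : Set α
  /-- the blocks -/
  blocks : Set (Set α)
  /-- the block containing `z'` and `F` -/
  A₀ : Set α
  /-- the first of the two blocks that may overlap -/
  A₁ : Set α
  /-- the second of the two blocks that may overlap -/
  A₂ : Set α
  w_injective : Function.Injective w
  w_ne_z : ∀ i, w i ≠ z
  ncard_block : ∀ A ∈ blocks, A.ncard = k - 1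
  w_notMem : ∀ A ∈ blocks, ∀ i, w i ∉ A
  z_notMem : ∀ A ∈ blocks, z ∉ A
  cover : ∀ x, (∀ i, x ≠ w i) → x ≠ z → ∃ A ∈ blocks, x ∈ A
  A₀_mem : A₀ ∈ blocks
  A₁_mem : A₁ ∈ blocks
  A₂_mem : A₂ ∈ blocks
  z'_mem : z' ∈ A₀
  F_subset : F ⊆ A₀
  z'_notMem : z' ∉ F
  ncard_F : F.ncard = k - 3
  A₀_ne_A₁ : A₀ ≠ A₁
  A₀_ne_A₂ : A₀ ≠ A₂
  eq_of_mem : ∀ A ∈ blocks, ∀ B ∈ blocks, ∀ x, x ∈ A → x ∈ B → A ≠ B →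
    (A = A₁ ∧ B = A₂) ∨ (A = A₂ ∧ B = A₁)

namespace BlockFrame

variable {α : Type*} {m k : ℕ} (S : BlockFrame α m k)

/-- The edge joining the block `A` to `w i`. -/
def blockEdge (A : Set α) (i : Fin m) : Set α := insert (S.w i) A

/-- The edge joining `w i` and `w j`; it contains `z` as well. -/
def coreEdge (i j : Fin m) : Set α := insert (S.w i) (insert (S.w j) (insert S.z S.F))

/-- The edge joining `w i` and `z`; it contains `z'` as well. -/
def apexEdge (i : Fin m) : Set α := insert (S.w i) (insert S.z (insert S.z' S.F))

/-- The edges of the construction. -/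
def edges : Set (Set α) :=
  {e | (∃ A ∈ S.blocks, ∃ i, e = S.blockEdge A i) ∨ (∃ i j, i < j ∧ e = S.coreEdge i j) ∨
    ∃ i, e = S.apexEdge i}

theorem blockEdge_mem {A : Set α} (hA : A ∈ S.blocks) (i : Fin m) : S.blockEdge A i ∈ S.edges :=
  Or.inl ⟨A, hA, i, rfl⟩

theorem coreEdge_mem {i j : Fin m} (h : i < j) : S.coreEdge i j ∈ S.edges :=
  Or.inr (Or.inl ⟨i, j, h, rfl⟩)

theorem apexEdge_mem (i : Fin m) : S.apexEdge i ∈ S.edges := Or.inr (Or.inr ⟨i, rfl⟩)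

theorem w_notMem_F (i : Fin m) : S.w i ∉ S.F := fun h => S.w_notMem _ S.A₀_mem i (S.F_subset h)

theorem z_notMem_F : S.z ∉ S.F := fun h => S.z_notMem _ S.A₀_mem (S.F_subset h)

theorem w_ne_z' (i : Fin m) : S.w i ≠ S.z' := fun h =>
  S.w_notMem _ S.A₀_mem i (h ▸ S.z'_mem)

theorem z_ne_z' : S.z ≠ S.z' := fun h => S.z_notMem _ S.A₀_mem (h ▸ S.z'_mem)

theorem w_mem_blockEdge {A : Set α} (hA : A ∈ S.blocks) {i j : Fin m} :
    S.w j ∈ S.blockEdge A i ↔ j = i := by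
  simp [blockEdge, S.w_injective.eq_iff, S.w_notMem A hA]

theorem w_mem_coreEdge {i j x : Fin m} : S.w x ∈ S.coreEdge i j ↔ x = i ∨ x = j := by
  simp [coreEdge, S.w_injective.eq_iff, S.w_ne_z, S.w_notMem_F]

theorem w_mem_apexEdge {i x : Fin m} : S.w x ∈ S.apexEdge i ↔ x = i := by
  simp [apexEdge, S.w_injective.eq_iff, S.w_ne_z, S.w_notMem_F, S.w_ne_z']

theorem z_notMem_blockEdge {A : Set α} (hA : A ∈ S.blocks) (i : Fin m) :
    S.z ∉ S.blockEdge A i := by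
  simp [blockEdge, (S.w_ne_z i).symm, S.z_notMem A hA]

theorem z_mem_coreEdge (i j : Fin m) : S.z ∈ S.coreEdge i j := by simp [coreEdge]

theorem z_mem_apexEdge (i : Fin m) : S.z ∈ S.apexEdge i := by simp [apexEdge]

theorem z'_notMem_coreEdge (i j : Fin m) : S.z' ∉ S.coreEdge i j := by
  simp [coreEdge, (S.w_ne_z' _).symm, S.z_ne_z'.symm, S.z'_notMem]

theorem z'_mem_apexEdge (i : Fin m) : S.z' ∈ S.apexEdge i := by simp [apexEdge]

theorem blockEdge_left_injective {A : Set α} (hA : A ∈ S.blocks) :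
    Function.Injective (S.blockEdge A) := fun _ _ h =>
  (S.w_mem_blockEdge hA).1 (h ▸ (S.w_mem_blockEdge hA).2 rfl)

theorem apexEdge_injective : Function.Injective S.apexEdge := fun _ _ h =>
  S.w_mem_apexEdge.1 (h ▸ S.w_mem_apexEdge.2 rfl)

theorem coreEdge_inj {i j i' j' : Fin m} (h : i < j) (h' : i' < j')
    (heq : S.coreEdge i j = S.coreEdge i' j') : i = i' ∧ j = j' := by
  have h1 : i = i' ∨ i = j' := S.w_mem_coreEdge.1 (heq ▸ S.w_mem_coreEdge.2 (Or.inl rfl))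
  have h2 : j = i' ∨ j = j' := S.w_mem_coreEdge.1 (heq ▸ S.w_mem_coreEdge.2 (Or.inr rfl))
  omega

theorem blockEdge_ne_coreEdge {A : Set α} (hA : A ∈ S.blocks) (x i j : Fin m) :
    S.blockEdge A x ≠ S.coreEdge i j := fun h =>
  S.z_notMem_blockEdge hA x (h ▸ S.z_mem_coreEdge i j)

theorem blockEdge_ne_apexEdge {A : Set α} (hA : A ∈ S.blocks) (x i : Fin m) :
    S.blockEdge A x ≠ S.apexEdge i := fun h =>
  S.z_notMem_blockEdge hA x (h ▸ S.z_mem_apexEdge i)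

theorem apexEdge_ne_coreEdge (x i j : Fin m) : S.apexEdge x ≠ S.coreEdge i j := fun h =>
  S.z'_notMem_coreEdge i j (h ▸ S.z'_mem_apexEdge x)

theorem ncard_of_mem_edges [Finite α] (hk : 3 ≤ k) {e : Set α} (he : e ∈ S.edges) :
    e.ncard = k := by
  rcases he with ⟨A, hA, i, rfl⟩ | ⟨i, j, hij, rfl⟩ | ⟨i, rfl⟩
  · rw [blockEdge, Set.ncard_insert_of_notMem (S.w_notMem A hA i), S.ncard_block A hA]; omega
  · rw [coreEdge, Set.ncard_insert_of_notMem, Set.ncard_insert_of_notMem,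
      Set.ncard_insert_of_notMem S.z_notMem_F, S.ncard_F]
    · omega
    · simp [S.w_ne_z, S.w_notMem_F]
    · simp [S.w_ne_z, S.w_notMem_F, S.w_injective.eq_iff, hij.ne]
  · rw [apexEdge, Set.ncard_insert_of_notMem, Set.ncard_insert_of_notMem,
      Set.ncard_insert_of_notMem S.z'_notMem, S.ncard_F]
    · omega
    · simp [S.z_ne_z', S.z_notMem_F]
    · simp [S.w_ne_z, S.w_notMem_F, S.w_ne_z']

theorem ncard_edges_le [Finite α] : S.edges.ncard ≤ S.blocks.ncard * m + (m * m + m) := by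
  have hsub : S.edges ⊆ ((fun p : Set α × Fin m => S.blockEdge p.1 p.2) '' (S.blocks ×ˢ Set.univ)) ∪
      (Set.range (fun p : Fin m × Fin m => S.coreEdge p.1 p.2) ∪ Set.range S.apexEdge) := by
    rintro e (⟨A, hA, i, rfl⟩ | ⟨i, j, hij, rfl⟩ | ⟨i, rfl⟩)
    · exact Or.inl ⟨(A, i), ⟨hA, trivial⟩, rfl⟩
    · exact Or.inr (Or.inl ⟨(i, j), rfl⟩)
    · exact Or.inr (Or.inr ⟨i, rfl⟩)
  refine (Set.ncard_le_ncard hsub).trans ((Set.ncard_union_le _ _).trans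
    (add_le_add ?_ ((Set.ncard_union_le _ _).trans (add_le_add ?_ ?_))))
  · refine (Set.ncard_image_le).trans ?_
    rw [Set.ncard_prod, Set.ncard_univ, Nat.card_fin]
  · rw [← Set.image_univ]
    refine (Set.ncard_image_le).trans ?_
    rw [Set.ncard_univ]; simp
  · rw [← Set.image_univ]
    refine (Set.ncard_image_le).trans ?_
    rw [Set.ncard_univ]; simp

/-- Exchange step: a new edge through `w i` and `w j` takes over the pair `w i, w j`; then
`coreEdge i j` becomes free for `w i, z`, and `apexEdge i` for `z, z'`, the only pair of the clique
on all `w x`, `z`, `z'` without an edge of its own so far. -/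
theorem hasBergeClique_insert_of_core {e : Set α} (he : e ∉ S.edges) {i j : Fin m} (hij : i < j)
    (hi : S.w i ∈ e) (hj : S.w j ∈ e) : HasBergeClique (m + 2) (insert e S.edges) := by
  classical
  have hne : ∀ g ∈ S.edges, e ≠ g := fun g hg h => he (h ▸ hg)
  refine HasBergeClique.of_cone (u := S.z) (v := S.z') (e := S.apexEdge i)
    (a := fun x => if x = i then S.coreEdge i j else S.apexEdge x) (b := S.blockEdge S.A₀)
    (c := fun x y => if x = i ∧ y = j then e else S.coreEdge x y)
    S.w_injective S.z_ne_z' S.w_ne_z S.w_ne_z' ?_ ?_ ?_ ?_ ?_ ?_ ?_ ?_ ?_ ?_ ?_ ?_ ?_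
  · exact ⟨Or.inr (S.apexEdge_mem i), S.z_mem_apexEdge i, S.z'_mem_apexEdge i⟩
  · intro x
    by_cases hx : x = i
    · subst hx
      simp only [if_true]
      exact ⟨Or.inr (S.coreEdge_mem hij), S.z_mem_coreEdge _ _, S.w_mem_coreEdge.2 (Or.inl rfl)⟩
    · simp only [hx, if_false]
      exact ⟨Or.inr (S.apexEdge_mem x), S.z_mem_apexEdge x, S.w_mem_apexEdge.2 rfl⟩
  · exact fun x => ⟨Or.inr (S.blockEdge_mem S.A₀_mem x), Or.inr S.z'_mem, Or.inl rfl⟩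
  · intro x y hxy
    by_cases h : x = i ∧ y = j
    · simp only [h, and_self, if_true]
      exact ⟨Or.inl rfl, hi, hj⟩
    · simp only [h, if_false]
      exact ⟨Or.inr (S.coreEdge_mem hxy), S.w_mem_coreEdge.2 (Or.inl rfl),
        S.w_mem_coreEdge.2 (Or.inr rfl)⟩
  · intro x y hxy
    by_cases hx : x = i <;> by_cases hy : y = i <;> simp only [hx, hy, if_true, if_false] at hxy
    · rw [hx, hy]
    · exact absurd hxy.symm (S.apexEdge_ne_coreEdge _ _ _)
    · exact absurd hxy (S.apexEdge_ne_coreEdge _ _ _)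
    · exact S.apexEdge_injective hxy
  · exact S.blockEdge_left_injective S.A₀_mem
  · intro x y x' y' hxy hxy' h
    by_cases hx : x = i ∧ y = j <;> by_cases hy : x' = i ∧ y' = j <;>
      simp only [hx, hy, if_false] at h
    · exact ⟨hx.1.trans hy.1.symm, hx.2.trans hy.2.symm⟩
    · exact absurd h (hne _ (S.coreEdge_mem hxy'))
    · exact absurd h.symm (hne _ (S.coreEdge_mem hxy))
    · exact S.coreEdge_inj hxy hxy' h
  · intro x
    by_cases hx : x = i
    · simp only [hx, if_true]
      exact S.apexEdge_ne_coreEdge _ _ _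
    · simp only [hx, if_false]
      exact fun h => hx (S.apexEdge_injective h).symm
  · exact fun x => (S.blockEdge_ne_apexEdge S.A₀_mem _ _).symm
  · intro x y hxy
    by_cases h : x = i ∧ y = j
    · simp only [h, and_self, if_true]
      exact (hne _ (S.apexEdge_mem i)).symm
    · simp only [h, if_false]
      exact S.apexEdge_ne_coreEdge _ _ _
  · intro x y
    by_cases hx : x = i
    · simp only [hx, if_true]
      exact (S.blockEdge_ne_coreEdge S.A₀_mem _ _ _).symm
    · simp only [hx, if_false]
      exact (S.blockEdge_ne_apexEdge S.A₀_mem _ _).symm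
  · intro x y y' hyy
    by_cases hx : x = i <;> by_cases h : y = i ∧ y' = j <;> simp only [hx, h, if_true, if_false]
    · simpa using (hne _ (S.coreEdge_mem hij)).symm
    · intro hcon
      have := S.coreEdge_inj hij hyy hcon
      exact h ⟨this.1.symm, this.2.symm⟩
    · simpa using (hne _ (S.apexEdge_mem x)).symm
    · exact S.apexEdge_ne_coreEdge _ _ _
  · intro x y y' hyy
    by_cases h : y = i ∧ y' = j
    · simp only [h, and_self, if_true]
      exact (hne _ (S.blockEdge_mem S.A₀_mem x)).symm
    · simp only [h, if_false]
      exact S.blockEdge_ne_coreEdge S.A₀_mem _ _ _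

/-- Any missing `k`-set that meets a block other than `A₀`, `A₁`, `A₂` creates a Berge clique. -/
theorem hasBergeClique_insert [Finite α] (hk : 3 ≤ k) {e : Set α} (he : e ∉ S.edges)
    (hek : e.ncard = k) {u : α} (hu : u ∈ e) {A : Set α} (hA : A ∈ S.blocks) (huA : u ∈ A)
    (h₁ : A ≠ S.A₁) (h₂ : A ≠ S.A₂) :
    HasBergeClique (m + 2) (insert e S.edges) := by
  have hne : ∀ g ∈ S.edges, e ≠ g := fun g hg h => he (h ▸ hg)
  have hwu : ∀ i, S.w i ≠ u := fun i h => S.w_notMem A hA i (h ▸ huA)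
  have huz : u ≠ S.z := fun h => S.z_notMem A hA (h ▸ huA)
  by_cases hz : S.z ∈ e
  · exact HasBergeClique.of_cone (u := u) (v := S.z) (e := e) (a := S.blockEdge A)
      (b := S.apexEdge) (c := S.coreEdge) S.w_injective huz hwu S.w_ne_z
      ⟨Or.inl rfl, hu, hz⟩
      (fun i => ⟨Or.inr (S.blockEdge_mem hA i), Or.inr huA, Or.inl rfl⟩)
      (fun i => ⟨Or.inr (S.apexEdge_mem i), S.z_mem_apexEdge i, S.w_mem_apexEdge.2 rfl⟩)
      (fun i j hij => ⟨Or.inr (S.coreEdge_mem hij), S.w_mem_coreEdge.2 (Or.inl rfl),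
        S.w_mem_coreEdge.2 (Or.inr rfl)⟩)
      (S.blockEdge_left_injective hA) S.apexEdge_injective
      (fun _ _ _ _ => S.coreEdge_inj)
      (fun i => hne _ (S.blockEdge_mem hA i)) (fun i => hne _ (S.apexEdge_mem i))
      (fun _ _ h => hne _ (S.coreEdge_mem h)) (fun _ _ => S.blockEdge_ne_apexEdge hA _ _)
      (fun _ _ _ _ => S.blockEdge_ne_coreEdge hA _ _ _)
      (fun _ _ _ _ => S.apexEdge_ne_coreEdge _ _ _)
  by_cases hv : ∃ v ∈ e, (∀ i, v ≠ S.w i) ∧ v ∉ A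
  · obtain ⟨v, hve, hvw, hvA⟩ := hv
    obtain ⟨B, hB, hvB⟩ := S.cover v hvw (fun h => hz (h ▸ hve))
    have hAB : ∀ i j, S.blockEdge A i ≠ S.blockEdge B j := by
      intro i j h
      have huB : u ∈ S.blockEdge B j := h ▸ Or.inr huA
      rcases S.eq_of_mem A hA B hB u huA (huB.resolve_left (hwu j).symm)
        (fun h => hvA (h ▸ hvB)) with h | h
      · exact h₁ h.1
      · exact h₂ h.1
    exact HasBergeClique.of_cone (u := u) (v := v) (e := e) (a := S.blockEdge A)
      (b := S.blockEdge B) (c := S.coreEdge) S.w_injective (fun h => hvA (h ▸ huA)) hwu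
      (fun i => (hvw i).symm) ⟨Or.inl rfl, hu, hve⟩
      (fun i => ⟨Or.inr (S.blockEdge_mem hA i), Or.inr huA, Or.inl rfl⟩)
      (fun i => ⟨Or.inr (S.blockEdge_mem hB i), Or.inr hvB, Or.inl rfl⟩)
      (fun i j hij => ⟨Or.inr (S.coreEdge_mem hij), S.w_mem_coreEdge.2 (Or.inl rfl),
        S.w_mem_coreEdge.2 (Or.inr rfl)⟩)
      (S.blockEdge_left_injective hA) (S.blockEdge_left_injective hB)
      (fun _ _ _ _ => S.coreEdge_inj)
      (fun i => hne _ (S.blockEdge_mem hA i)) (fun i => hne _ (S.blockEdge_mem hB i))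
      (fun _ _ h => hne _ (S.coreEdge_mem h)) hAB
      (fun _ _ _ _ => S.blockEdge_ne_coreEdge hA _ _ _)
      (fun _ _ _ _ => S.blockEdge_ne_coreEdge hB _ _ _)
  · push Not at hv
    -- Now `e` lies in the union of `A` and all `w i`; as `|A| = k - 1` and `e` is not a block edge,
    -- it contains two of the `w i`.
    obtain ⟨x, hx⟩ : ∃ x, S.w x ∈ e := by
      by_contra! hcon
      have hsub : e ⊆ A := fun v hve => hv v hve fun i h => hcon i (h ▸ hve)
      have := Set.ncard_le_ncard hsub
      rw [hek, S.ncard_block A hA] at this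
      omega
    obtain ⟨y, hy, hyx⟩ : ∃ y, S.w y ∈ e ∧ y ≠ x := by
      by_contra! hcon
      have hsub : e ⊆ S.blockEdge A x := by
        intro v hve
        by_cases h : v = S.w x
        · exact Or.inl h
        · exact Or.inr (hv v hve fun i hi => h (by rw [hi, hcon i (hi ▸ hve)]))
      refine hne _ (S.blockEdge_mem hA x) (Set.eq_of_subset_of_ncard_le hsub ?_)
      rw [hek, S.ncard_of_mem_edges hk (S.blockEdge_mem hA x)]
    rcases lt_or_gt_of_ne hyx with h | h
    · exact S.hasBergeClique_insert_of_core he h hy hx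
    · exact S.hasBergeClique_insert_of_core he h hx hy

/-- The only edges through a vertex that is neither some `w i` nor `z` nor in `A₀` are the block
edges of the blocks containing it. -/
theorem exists_blockEdge_of_mem {e : Set α} (he : e ∈ S.edges) {x : α} (hx : x ∈ e)
    (hw : ∀ i, x ≠ S.w i) (hz : x ≠ S.z) (h₀ : x ∉ S.A₀) :
    ∃ A ∈ S.blocks, x ∈ A ∧ ∃ i, e = S.blockEdge A i := by
  rcases he with ⟨A, hA, i, rfl⟩ | ⟨i, j, hij, rfl⟩ | ⟨i, rfl⟩
  · exact ⟨A, hA, hx.resolve_left (hw i), i, rfl⟩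
  · exfalso
    rcases hx with h | h | h | h
    · exact hw _ h
    · exact hw _ h
    · exact hz h
    · exact h₀ (S.F_subset h)
  · exfalso
    rcases hx with h | h | h | h
    · exact hw _ h
    · exact hz h
    · exact h₀ (h ▸ S.z'_mem)
    · exact h₀ (S.F_subset h)

/-- Every core vertex of a Berge clique has degree at least `m + 1`, hence is a `w i` or `z`, or
lies in `A₀` or in two blocks. -/
theorem core_vertex_cases {f : Fin (m + 2) → α} {φ : Sym2 (Fin (m + 2)) → Set α}
    (hφ : ∀ i j, i ≠ j → φ s(i, j) ∈ S.edges ∧ f i ∈ φ s(i, j))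
    (hinj : ∀ s t, ¬ s.IsDiag → ¬ t.IsDiag → φ s = φ t → s = t) (p : Fin (m + 2)) :
    ((∃ i, f p = S.w i) ∨ f p = S.z ∨ f p ∈ S.A₀) ∨ (f p ∈ S.A₁ ∧ f p ∈ S.A₂) := by
  classical
  by_contra! hcon
  obtain ⟨⟨hw, hz, h₀⟩, h₁₂⟩ := hcon
  obtain ⟨A, hA, hpA⟩ := S.cover _ hw hz
  have huniq : ∀ B ∈ S.blocks, f p ∈ B → B = A := by
    intro B hB hpB
    by_contra hBA
    rcases S.eq_of_mem B hB A hA _ hpB hpA hBA with ⟨rfl, rfl⟩ | ⟨rfl, rfl⟩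
    · exact h₁₂ hpB hpA
    · exact h₁₂ hpA hpB
  have hlab : ∀ q, ∃ i, q ≠ p → φ s(p, q) = S.blockEdge A i := by
    intro q
    by_cases hq : q = p
    · have hm : 0 < m := by
        obtain ⟨r, hr⟩ := exists_ne p
        obtain ⟨B, hB, hpB, i, hi⟩ :=
          S.exists_blockEdge_of_mem (hφ p r hr.symm).1 (hφ p r hr.symm).2 hw hz h₀
        exact i.pos
      exact ⟨⟨0, hm⟩, fun h => absurd hq h⟩
    · obtain ⟨B, hB, hpB, i, hi⟩ :=
        S.exists_blockEdge_of_mem (hφ p q (Ne.symm hq)).1 (hφ p q (Ne.symm hq)).2 hw hz h₀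
      exact ⟨i, fun _ => by rw [hi, huniq B hB hpB]⟩
  choose l hl using hlab
  obtain ⟨x, hx, y, hy, hxy, hlxy⟩ := Finset.exists_ne_map_eq_of_card_lt_of_maps_to
    (s := Finset.univ.erase p) (t := (Finset.univ : Finset (Fin m))) (f := l)
    (by simp [Finset.card_erase_of_mem]) (fun _ _ => Finset.mem_coe.2 (Finset.mem_univ _))
  have hx' := Finset.ne_of_mem_erase hx
  have hy' := Finset.ne_of_mem_erase hy
  refine hxy (Sym2.congr_right.1 (hinj s(p, x) s(p, y) ?_ ?_ ?_))
  · simpa using hx'.symm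
  · simpa using hy'.symm
  · rw [hl x hx', hl y hy', hlxy]

/-- No core vertex of a Berge clique lies in two blocks: the neighbours of a vertex of `A₁ ∩ A₂`
outside the blocks `A₁` and `A₂` are the `m` vertices `w i`, and two such vertices lie in `2 m`
edges only, while they would need `2 m + 1`. -/
theorem core_vertex_notMem_inter {f : Fin (m + 2) → α} (hf : Function.Injective f)
    {φ : Sym2 (Fin (m + 2)) → Set α}
    (hφ : ∀ i j, i ≠ j → φ s(i, j) ∈ S.edges ∧ f i ∈ φ s(i, j))
    (hinj : ∀ s t, ¬ s.IsDiag → ¬ t.IsDiag → φ s = φ t → s = t) (p : Fin (m + 2)) :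
    ¬ (f p ∈ S.A₁ ∧ f p ∈ S.A₂) := by
  classical
  rintro ⟨hp₁, hp₂⟩
  have h₁ := S.A₁_mem
  have h₂ := S.A₂_mem
  have hw : ∀ A ∈ S.blocks, ∀ x ∈ A, ∀ i, x ≠ S.w i := fun A hA x hx i h =>
    S.w_notMem A hA i (h ▸ hx)
  have hz : ∀ A ∈ S.blocks, ∀ x ∈ A, x ≠ S.z := fun A hA x hx h => S.z_notMem A hA (h ▸ hx)
  have hdis₁ : ∀ x ∈ S.A₁, x ∉ S.A₀ := fun x hx hx₀ => by
    rcases S.eq_of_mem _ S.A₀_mem _ h₁ x hx₀ hx S.A₀_ne_A₁ with h | h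
    · exact S.A₀_ne_A₁ h.1
    · exact S.A₀_ne_A₂ h.1
  have hdis₂ : ∀ x ∈ S.A₂, x ∉ S.A₀ := fun x hx hx₀ => by
    rcases S.eq_of_mem _ S.A₀_mem _ h₂ x hx₀ hx S.A₀_ne_A₂ with h | h
    · exact S.A₀_ne_A₁ h.1
    · exact S.A₀_ne_A₂ h.1
  have hlab : ∀ x ∈ S.A₁, x ∈ S.A₂ → ∀ e ∈ S.edges, x ∈ e →
      (∃ i, e = S.blockEdge S.A₁ i) ∨ ∃ i, e = S.blockEdge S.A₂ i := by
    intro x hx₁ hx₂ e he hxe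
    obtain ⟨A, hA, hxA, i, rfl⟩ := S.exists_blockEdge_of_mem he hxe (hw _ h₁ x hx₁)
      (hz _ h₁ x hx₁) (hdis₁ x hx₁)
    by_cases hA₁ : A = S.A₁
    · exact Or.inl ⟨i, by rw [hA₁]⟩
    · rcases S.eq_of_mem A hA _ h₁ x hxA hx₁ hA₁ with h | h
      · exact absurd h.1 hA₁
      · exact Or.inr ⟨i, by rw [h.1]⟩
  by_cases hex : ∃ q, q ≠ p ∧ f q ∈ S.A₁ ∧ f q ∈ S.A₂
  · obtain ⟨q, hqp, hq₁, hq₂⟩ := hex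
    let T : Finset (Sym2 (Fin (m + 2))) := (Finset.univ.erase p).image (fun x => s(p, x)) ∪
      (Finset.univ \ {p, q}).image (fun x => s(q, x))
    have hTc : T.card = 2 * m + 1 := by
      rw [Finset.card_union_of_disjoint, Finset.card_image_of_injective,
        Finset.card_image_of_injective, Finset.card_sdiff, Finset.inter_univ,
        Finset.card_pair hqp.symm, Finset.card_erase_of_mem (Finset.mem_univ _), Finset.card_univ,
        Fintype.card_fin]
      · omega
      · exact fun _ _ h => Sym2.congr_right.1 h
      · exact fun _ _ h => Sym2.congr_right.1 h
      · rw [Finset.disjoint_left]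
        intro s hs ht
        obtain ⟨x, hx, rfl⟩ := Finset.mem_image.1 hs
        obtain ⟨y, hy, hxy⟩ := Finset.mem_image.1 ht
        simp only [Finset.mem_sdiff, Finset.mem_univ, Finset.mem_insert, Finset.mem_singleton,
          true_and, not_or] at hy
        rw [Sym2.eq_iff] at hxy
        rcases hxy with h | h
        · exact hqp h.1
        · exact hy.1 h.2
    have hTd : ∀ s ∈ T, ¬ s.IsDiag := by
      intro s hs
      rcases Finset.mem_union.1 hs with h | h
      · obtain ⟨x, hx, rfl⟩ := Finset.mem_image.1 h
        simpa using (Finset.ne_of_mem_erase hx).symm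
      · obtain ⟨x, hx, rfl⟩ := Finset.mem_image.1 h
        simp only [Finset.mem_sdiff, Finset.mem_univ, Finset.mem_insert, Finset.mem_singleton,
          true_and, not_or] at hx
        simpa using Ne.symm hx.2
    let R : Finset (Set α) := Finset.univ.image (S.blockEdge S.A₁) ∪
      Finset.univ.image (S.blockEdge S.A₂)
    have hRc : R.card ≤ 2 * m := by
      refine (Finset.card_union_le _ _).trans ?_
      have h1 := Finset.card_image_le (s := (Finset.univ : Finset (Fin m)))
        (f := S.blockEdge S.A₁)
      have h2 := Finset.card_image_le (s := (Finset.univ : Finset (Fin m)))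
        (f := S.blockEdge S.A₂)
      rw [Finset.card_univ, Fintype.card_fin] at h1 h2
      omega
    have hTR : ∀ s ∈ T, φ s ∈ R := by
      intro s hs
      have key : (∃ i, φ s = S.blockEdge S.A₁ i) ∨ ∃ i, φ s = S.blockEdge S.A₂ i := by
        have hsd := hTd s hs
        rcases Finset.mem_union.1 hs with h | h
        · obtain ⟨x, hx, rfl⟩ := Finset.mem_image.1 h
          have := hφ p x (by simpa using hsd)
          exact hlab _ hp₁ hp₂ _ this.1 this.2
        · obtain ⟨x, hx, rfl⟩ := Finset.mem_image.1 h
          have := hφ q x (by simpa using hsd)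
          exact hlab _ hq₁ hq₂ _ this.1 this.2
      rcases key with ⟨i, hi⟩ | ⟨i, hi⟩
      · exact Finset.mem_union_left _ (Finset.mem_image.2 ⟨i, Finset.mem_univ _, hi.symm⟩)
      · exact Finset.mem_union_right _ (Finset.mem_image.2 ⟨i, Finset.mem_univ _, hi.symm⟩)
    have := Finset.card_le_card_of_injOn φ hTR
      (fun s hs t ht h => hinj s t (hTd s hs) (hTd t ht) h)
    omega
  · push Not at hex
    have hW : ∀ q, ∃ i, q ≠ p → f q = S.w i := by
      intro q
      by_cases hq : q = p
      · have hm : 0 < m := by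
          obtain ⟨r, hr⟩ := exists_ne p
          rcases hlab _ hp₁ hp₂ _ (hφ p r hr.symm).1 (hφ p r hr.symm).2 with ⟨i, -⟩ | ⟨i, -⟩ <;>
            exact i.pos
        exact ⟨⟨0, hm⟩, fun h => absurd hq h⟩
      · have hqe : f q ∈ φ s(p, q) := by rw [Sym2.eq_swap]; exact (hφ q p hq).2
        have hcase := S.core_vertex_cases hφ hinj q
        rcases hlab _ hp₁ hp₂ _ (hφ p q (Ne.symm hq)).1 (hφ p q (Ne.symm hq)).2 with
          ⟨i, hi⟩ | ⟨i, hi⟩ <;> rw [hi] at hqe <;> rcases hqe with h | h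
        · exact ⟨i, fun _ => h⟩
        · rcases hcase with (⟨j, hj⟩ | hj | hj) | hj
          · exact ⟨j, fun _ => hj⟩
          · exact absurd hj (hz _ h₁ _ h)
          · exact absurd hj (hdis₁ _ h)
          · exact absurd hj.2 (hex q hq hj.1)
        · exact ⟨i, fun _ => h⟩
        · rcases hcase with (⟨j, hj⟩ | hj | hj) | hj
          · exact ⟨j, fun _ => hj⟩
          · exact absurd hj (hz _ h₂ _ h)
          · exact absurd hj (hdis₂ _ h)
          · exact absurd hj.2 (hex q hq hj.1)
    choose l hl using hW
    obtain ⟨x, hx, y, hy, hxy, hlxy⟩ := Finset.exists_ne_map_eq_of_card_lt_of_maps_to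
      (s := Finset.univ.erase p) (t := (Finset.univ : Finset (Fin m))) (f := l)
      (by simp [Finset.card_erase_of_mem]) (fun _ _ => Finset.mem_coe.2 (Finset.mem_univ _))
    exact hxy (hf (by
      rw [hl x (Finset.ne_of_mem_erase hx), hl y (Finset.ne_of_mem_erase hy), hlxy]))

/-- The construction contains no Berge-`K_{m+2}`: the core lies in `A₀` together with `z` and the
`w i`, and only `binom(m, 2) + 2 m = binom(m + 2, 2) - 1` edges have two vertices there. -/
theorem not_hasBergeClique : ¬ HasBergeClique (m + 2) S.edges := by
  classical
  rintro ⟨f, hf, φ, hφ, hinj⟩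
  have hcore : ∀ p, (∃ i, f p = S.w i) ∨ f p = S.z ∨ f p ∈ S.A₀ := fun p =>
    (S.core_vertex_cases hφ hinj p).resolve_right
      (S.core_vertex_notMem_inter hf hφ hinj p)
  have hblock : ∀ A ∈ S.blocks, ∀ i p, f p ∈ S.blockEdge A i → A ≠ S.A₀ → f p = S.w i := by
    intro A hA i p hp hA₀
    rcases hp with hp | hp
    · exact hp
    · exfalso
      rcases hcore p with ⟨j, hj⟩ | hj | hj
      · exact S.w_notMem A hA j (hj ▸ hp)
      · exact S.z_notMem A hA (hj ▸ hp)
      · rcases S.eq_of_mem _ S.A₀_mem A hA _ hj hp hA₀.symm with h | h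
        · exact S.A₀_ne_A₁ h.1
        · exact S.A₀_ne_A₂ h.1
  let T : Finset (Sym2 (Fin (m + 2))) := Finset.univ.filter fun s => ¬ s.IsDiag
  let R : Finset (Set α) := ((Finset.univ.filter fun s : Sym2 (Fin m) => ¬ s.IsDiag).image
      fun s => S.coreEdge s.inf s.sup) ∪
    (Finset.univ.image (S.blockEdge S.A₀) ∪ Finset.univ.image S.apexEdge)
  have hcard : ∀ n : ℕ, (Finset.univ.filter fun s : Sym2 (Fin n) => ¬ s.IsDiag).card =
      n.choose 2 := by
    intro n
    have := Sym2.card_subtype_not_diag (α := Fin n)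
    rw [Fintype.card_subtype, Fintype.card_fin] at this
    exact this
  have hRc : R.card ≤ m.choose 2 + (m + m) := by
    refine (Finset.card_union_le _ _).trans (add_le_add ?_
      ((Finset.card_union_le _ _).trans (add_le_add ?_ ?_)))
    · exact Finset.card_image_le.trans (hcard m).le
    · exact Finset.card_image_le.trans (by simp)
    · exact Finset.card_image_le.trans (by simp)
  have hTR : ∀ s ∈ T, φ s ∈ R := by
    intro s hs
    have hsd : ¬ s.IsDiag := (Finset.mem_filter.1 hs).2
    induction s with
    | _ p q =>
      have hpq : p ≠ q := by simpa using hsd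
      have hp := hφ p q hpq
      have hq : f q ∈ φ s(p, q) := by rw [Sym2.eq_swap]; exact (hφ q p hpq.symm).2
      rcases hp.1 with ⟨A, hA, i, hi⟩ | ⟨i, j, hij, hi⟩ | ⟨i, hi⟩
      · by_cases hA₀ : A = S.A₀
        · exact Finset.mem_union_right _ (Finset.mem_union_left _
            (Finset.mem_image.2 ⟨i, Finset.mem_univ _, by rw [hi, hA₀]⟩))
        · refine absurd (hf ?_) hpq
          rw [hblock A hA i p (hi ▸ hp.2) hA₀, hblock A hA i q (hi ▸ hq) hA₀]
      · refine Finset.mem_union_left _ (Finset.mem_image.2 ⟨s(i, j), ?_, ?_⟩)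
        · simpa using hij.ne
        · simp [hi, hij.le]
      · exact Finset.mem_union_right _ (Finset.mem_union_right _
          (Finset.mem_image.2 ⟨i, Finset.mem_univ _, hi.symm⟩))
  have hle := Finset.card_le_card_of_injOn φ hTR fun s hs t ht h =>
    hinj s t (Finset.mem_filter.1 hs).2 (Finset.mem_filter.1 ht).2 h
  have h3 : (m + 2).choose 2 = m.choose 2 + (m + m) + 1 := by
    rw [Nat.choose_succ_succ (m + 1) 1, Nat.choose_succ_succ m 1]
    simp
    ring
  have h4 : T.card = (m + 2).choose 2 := hcard (m + 2)
  omega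

end BlockFrame

/-! ### The upper bound -/

/-- A Berge-clique-free hypergraph such that every missing `k`-set not contained in `T` creates a
Berge clique: a maximal Berge-clique-free extension is saturated and only has new edges inside
`T`. -/
theorem exists_saturated {α : Type*} [Finite α] {ℓ k : ℕ} {E₀ : Set (Set α)}
    (hunif : ∀ e ∈ E₀, e.ncard = k) (hfree : ¬ HasBergeClique ℓ E₀) (T : Set α)
    (hT : ∀ e : Set α, e.ncard = k → e ∉ E₀ → ¬ e ⊆ T → HasBergeClique ℓ (insert e E₀)) :
    ∃ H : Hypergraph α, H.vertexSet = Set.univ ∧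
      IsBergeSaturated (SimpleGraph.completeGraph (Fin ℓ)) k H ∧
      H.edgeSet.ncard ≤ E₀.ncard + 2 ^ T.ncard := by
  obtain ⟨E, hE₀, hE⟩ := Finite.exists_le_maximal
    (p := fun E : Set (Set α) => (∀ e ∈ E, e.ncard = k) ∧ ¬ HasBergeClique ℓ E) ⟨hunif, hfree⟩
  refine ⟨⟨Set.univ, E, fun _ _ => Set.subset_univ _⟩, rfl, ⟨?_, ?_, ?_⟩, ?_⟩
  · intro e he
    rw [← (Set.toFinite e).cast_ncard_eq, hE.prop.1 e he]
  · rw [containsBerge_completeGraph_iff rfl]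
    exact hE.prop.2
  · intro e he hek heE
    rw [containsBerge_completeGraph_iff rfl]
    by_contra hcon
    have hek' : e.ncard = k := by
      rw [← (Set.toFinite e).cast_ncard_eq] at hek
      exact_mod_cast hek
    refine heE (hE.le_of_ge (y := insert e E) ⟨?_, hcon⟩ (Set.subset_insert e E)
      (Set.mem_insert e E))
    rintro g (rfl | hg)
    · exact hek'
    · exact hE.prop.1 g hg
  · have hsub : E ⊆ E₀ ∪ 𝒫 T := by
      intro e he
      by_contra hcon
      rw [Set.mem_union, not_or] at hcon
      refine hE.prop.2 ((hT e (hE.prop.1 e he) hcon.1 hcon.2).mono ?_)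
      exact Set.insert_subset he hE₀
    calc E.ncard ≤ (E₀ ∪ 𝒫 T).ncard := Set.ncard_le_ncard hsub
      _ ≤ E₀.ncard + (𝒫 T).ncard := Set.ncard_union_le _ _
      _ = _ := by rw [Set.ncard_powerset]

/-- Completing the construction to a saturated hypergraph adds edges inside a set of bounded size
only. -/
theorem BlockFrame.exists_saturated {α : Type*} [Finite α] {m k : ℕ} (S : BlockFrame α m k)
    (hk : 3 ≤ k) :
    ∃ H : Hypergraph α, H.vertexSet = Set.univ ∧
      IsBergeSaturated (SimpleGraph.completeGraph (Fin (m + 2))) k H ∧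
      H.edgeSet.ncard ≤
        S.blocks.ncard * m + (m * m + m) + 2 ^ (m + 1 + ((k - 1) + ((k - 1) + (k - 1)))) := by
  let T : Set α := (Set.range S.w ∪ {S.z}) ∪ (S.A₀ ∪ (S.A₁ ∪ S.A₂))
  obtain ⟨H, hV, hH, hc⟩ := Hypergraph.exists_saturated
    (fun e he => S.ncard_of_mem_edges hk he) S.not_hasBergeClique T (by
      intro e hek he heT
      obtain ⟨u, hu, huT⟩ := Set.not_subset.1 heT
      simp only [T, Set.mem_union, Set.mem_range, Set.mem_singleton_iff, not_or, not_exists] at huT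
      obtain ⟨⟨hw, hz⟩, h₀, h₁, h₂⟩ := huT
      obtain ⟨A, hA, huA⟩ := S.cover u (fun i h => hw i h.symm) hz
      exact S.hasBergeClique_insert hk he hek hu hA huA (fun h => h₁ (h ▸ huA))
        (fun h => h₂ (h ▸ huA)))
  refine ⟨H, hV, hH, hc.trans (add_le_add S.ncard_edges_le (Nat.pow_le_pow_right two_pos ?_))⟩
  refine (Set.ncard_union_le _ _).trans (add_le_add ((Set.ncard_union_le _ _).trans
    (add_le_add ?_ (Set.ncard_singleton _).le)) ((Set.ncard_union_le _ _).trans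
    (add_le_add (S.ncard_block _ S.A₀_mem).le ((Set.ncard_union_le _ _).trans
    (add_le_add (S.ncard_block _ S.A₁_mem).le (S.ncard_block _ S.A₂_mem).le)))))
  rw [← Set.image_univ]
  refine (Set.ncard_image_le).trans ?_
  rw [Set.ncard_univ]; simp

theorem ncard_fin_interval {n a b : ℕ} (hb : b ≤ n) :
    {v : Fin n | a ≤ v.1 ∧ v.1 < b}.ncard = b - a := by
  rw [← Set.ncard_image_of_injective _ Fin.val_injective]
  have : Fin.val '' {v : Fin n | a ≤ v.1 ∧ v.1 < b} = (Finset.Ico a b : Set ℕ) := by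
    ext x
    simp only [Set.mem_image, Finset.coe_Ico, Set.mem_Ico]
    constructor
    · rintro ⟨v, hv, rfl⟩; exact hv
    · exact fun hx => ⟨⟨x, by omega⟩, hx, rfl⟩
  rw [this, Set.ncard_coe_finset, Nat.card_Ico]

/-- The interval of length `K` in `Fin n` that starts at `a + s`. -/
def finBlock (n a K s : ℕ) : Set (Fin n) := {v | a + s ≤ v.1 ∧ v.1 < a + s + K}

/-- On `Fin n`, the first `m + 1` vertices are the `w i` and `z`; the others are cut into intervals
of length `k - 1`, and the last block consists of the last `k - 1` vertices. It coincides with the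
previous block if `k - 1` divides the number of vertices to cover, and overlaps it otherwise. -/
theorem exists_blockFrame {n m k : ℕ} (hk : 3 ≤ k) (hn : m + 1 + 3 * (k - 1) ≤ n) :
    ∃ S : BlockFrame (Fin n) m k, S.blocks.ncard ≤ (n - (m + 1)) / (k - 1) + 1 := by
  obtain ⟨K, rfl⟩ : ∃ K, k = K + 1 := ⟨k - 1, by omega⟩
  obtain ⟨N, rfl⟩ : ∃ N, n = m + 1 + N := ⟨n - (m + 1), by omega⟩
  simp only [Nat.add_sub_cancel, Nat.add_sub_cancel_left] at hn ⊢
  have hK : 2 ≤ K := by omega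
  obtain ⟨q, hq⟩ : ∃ q, N / K = q + 1 := ⟨N / K - 1, by
    have : 3 ≤ N / K := (Nat.le_div_iff_mul_le (by omega)).2 (by omega)
    omega⟩
  have hq3 : 3 ≤ q + 1 := hq ▸ (Nat.le_div_iff_mul_le (by omega)).2 (by omega)
  have hqN : K * (q + 1) ≤ N := hq ▸ Nat.mul_div_le N K
  have hNq : N < K * (q + 1) + K := by
    have := Nat.lt_mul_div_succ N (show 0 < K by omega)
    rw [hq] at this
    linarith
  have hKq : K * 2 ≤ K * q := Nat.mul_le_mul_left _ (by omega)
  let I : ℕ → Set (Fin (m + 1 + N)) := finBlock (m + 1 + N) (m + 1) K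
  have hI : ∀ s v, v ∈ I s ↔ m + 1 + s ≤ v.1 ∧ v.1 < m + 1 + s + K := fun s v => Iff.rfl
  let blocks : Set (Set (Fin (m + 1 + N))) :=
    insert (I (N - K)) ((fun j => I (K * j)) '' Set.Iio (q + 1))
  have hblocks : ∀ A ∈ blocks, ∃ s, s + K ≤ N ∧ A = I s := by
    rintro A (rfl | ⟨j, hj, rfl⟩)
    · exact ⟨N - K, by omega, rfl⟩
    · have : K * (j + 1) ≤ K * (q + 1) := Nat.mul_le_mul_left _ (by simpa using hj)
      exact ⟨K * j, by linarith, rfl⟩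
  have hlast : ∀ j, j < q + 1 → ∀ x, x ∈ I (K * j) → x ∈ I (N - K) → j = q := by
    intro j hj x h1 h2
    rw [hI] at h1 h2
    by_contra hne
    have : K * (j + 1) ≤ K * q := Nat.mul_le_mul_left _ (by omega)
    rw [Nat.mul_add] at this hqN
    omega
  have hdisj : ∀ i j x, x ∈ I (K * i) → x ∈ I (K * j) → i = j := by
    intro i j x h1 h2
    rw [hI] at h1 h2
    have h3 : K * i < K * (j + 1) := by rw [Nat.mul_add]; omega
    have h4 : K * j < K * (i + 1) := by rw [Nat.mul_add]; omega
    have h5 := Nat.lt_of_mul_lt_mul_left h3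
    have h6 := Nat.lt_of_mul_lt_mul_left h4
    omega
  refine ⟨{
    w := fun i => ⟨i.1, by omega⟩
    z := ⟨m, by omega⟩
    z' := ⟨m + 1, by omega⟩
    F := {v | m + 2 ≤ v.1 ∧ v.1 < m + K}
    blocks := blocks
    A₀ := I (K * 0)
    A₁ := I (K * q)
    A₂ := I (N - K)
    w_injective := fun i j h => Fin.ext (by simpa using h)
    w_ne_z := fun i h => by
      have := congrArg Fin.val h
      simp only at this
      omega
    ncard_block := ?_
    w_notMem := ?_
    z_notMem := ?_
    cover := ?_
    A₀_mem := Or.inr ⟨0, by simp, rfl⟩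
    A₁_mem := Or.inr ⟨q, by simp, rfl⟩
    A₂_mem := Or.inl rfl
    z'_mem := (hI _ _).2 (by simp; omega)
    F_subset := fun v hv => (hI _ _).2 (by simp at hv; omega)
    z'_notMem := by simp
    ncard_F := by rw [ncard_fin_interval (by omega)]; omega
    A₀_ne_A₁ := ?_
    A₀_ne_A₂ := ?_
    eq_of_mem := ?_ }, ?_⟩
  · intro A hA
    obtain ⟨s, hs, rfl⟩ := hblocks A hA
    change {v : Fin (m + 1 + N) | _ ≤ v.1 ∧ v.1 < _}.ncard = _
    rw [ncard_fin_interval (by omega)]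
    omega
  · intro A hA i h
    obtain ⟨s, hs, rfl⟩ := hblocks A hA
    have := ((hI _ _).1 h).1
    simp only at this
    omega
  · intro A hA h
    obtain ⟨s, hs, rfl⟩ := hblocks A hA
    have := ((hI _ _).1 h).1
    simp only at this
    omega
  · intro x hxw hxz
    have hx : m + 1 ≤ x.1 := by
      by_contra hlt
      rcases Nat.lt_or_ge x.1 m with h | h
      · exact hxw ⟨x.1, h⟩ rfl
      · exact hxz (Fin.ext (by simp only; omega))
    have hxN := x.2
    by_cases hj : (x.1 - (m + 1)) / K < q + 1
    · refine ⟨_, Or.inr ⟨_, hj, rfl⟩, (hI _ _).2 ?_⟩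
      have h1 := Nat.mul_div_le (x.1 - (m + 1)) K
      have h2 := Nat.lt_mul_div_succ (x.1 - (m + 1)) (show 0 < K by omega)
      rw [Nat.mul_add] at h2
      omega
    · refine ⟨_, Or.inl rfl, (hI _ _).2 ?_⟩
      have h1 := (Nat.le_div_iff_mul_le (show 0 < K by omega)).1 (not_lt.1 hj)
      rw [Nat.mul_comm] at h1
      omega
  · intro h
    have h0 : (⟨m + 1, by omega⟩ : Fin (m + 1 + N)) ∈ I (K * 0) := (hI _ _).2 (by simp; omega)
    rw [h, hI] at h0
    simp only at h0
    omega
  · intro h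
    have h0 : (⟨m + 1, by omega⟩ : Fin (m + 1 + N)) ∈ I (K * 0) := (hI _ _).2 (by simp; omega)
    rw [h, hI] at h0
    simp only at h0
    omega
  · rintro A (rfl | ⟨i, hi, rfl⟩) B (rfl | ⟨j, hj, rfl⟩) x hxA hxB hAB
    · exact absurd rfl hAB
    · exact Or.inr ⟨rfl, by rw [hlast j hj x hxB hxA]⟩
    · exact Or.inl ⟨by rw [hlast i hi x hxA hxB], rfl⟩
    · exact absurd (by rw [hdisj i j x hxA hxB]) hAB
  · refine (Set.ncard_insert_le _ _).trans (Nat.add_le_add_right ?_ 1)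
    refine (Set.ncard_image_le (Set.finite_Iio _)).trans ?_
    rw [hq, ← Finset.coe_Iio, Set.ncard_coe_finset, Nat.card_Iio]

/-! ### The asymptotics of the saturation number -/

theorem exists_saturated_fin {n m k : ℕ} (hk : 3 ≤ k) (hn : m + 1 + 3 * (k - 1) ≤ n) :
    ∃ H : Hypergraph (Fin n), H.vertexSet = Set.univ ∧
      IsBergeSaturated (SimpleGraph.completeGraph (Fin (m + 2))) k H ∧
      H.edgeSet.ncard ≤ ((n - (m + 1)) / (k - 1) + 1) * m + (m * m + m) +
        2 ^ (m + 1 + ((k - 1) + ((k - 1) + (k - 1)))) := by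
  obtain ⟨S, hS⟩ := exists_blockFrame hk hn
  obtain ⟨H, hV, hH, hc⟩ := S.exists_saturated hk
  refine ⟨H, hV, hH, hc.trans ?_⟩
  gcongr

theorem bergeSat_le {m k : ℕ} (hk : 3 ≤ k) :
    ∃ C : ℝ, ∀ n : ℕ, m + 1 + 3 * (k - 1) ≤ n →
      (bergeSat k n (SimpleGraph.completeGraph (Fin (m + 2))) : ℝ) ≤
        (m : ℝ) / ((k : ℝ) - 1) * n + C := by
  refine ⟨((m + (m * m + m) + 2 ^ (m + 1 + ((k - 1) + ((k - 1) + (k - 1)))) : ℕ) : ℝ),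
    fun n hn => ?_⟩
  obtain ⟨H, hV, hH, hc⟩ := exists_saturated_fin hk hn
  have h1 : bergeSat k n (SimpleGraph.completeGraph (Fin (m + 2))) ≤ H.edgeSet.ncard :=
    Nat.sInf_le ⟨H, hV, hH, rfl⟩
  have h2 : (((n - (m + 1)) / (k - 1) : ℕ) : ℝ) ≤ (n : ℝ) / ((k : ℝ) - 1) := by
    refine Nat.cast_div_le.trans ?_
    rw [Nat.cast_sub (by omega : 1 ≤ k), Nat.cast_one]
    have hk' : (1 : ℝ) < k := by exact_mod_cast (by omega : 1 < k)
    gcongr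
    omega
  have h3 : (bergeSat k n (SimpleGraph.completeGraph (Fin (m + 2))) : ℝ) ≤
      (((n - (m + 1)) / (k - 1) : ℕ) : ℝ) * m +
        ((m + (m * m + m) + 2 ^ (m + 1 + ((k - 1) + ((k - 1) + (k - 1)))) : ℕ) : ℝ) := by
    rw [← Nat.cast_mul, ← Nat.cast_add, Nat.cast_le]
    refine (h1.trans hc).trans (le_of_eq ?_)
    ring
  refine h3.trans (add_le_add_left ?_ _)
  calc _ ≤ (n : ℝ) / ((k : ℝ) - 1) * m := by gcongr
    _ = _ := by ring

/-- The counting bound for saturated hypergraphs, applied to one with the least number of edges; `h`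
is the number of vertices of degree greater than `D`. -/
theorem le_bergeSat {n m k : ℕ} (hk : 3 ≤ k) (hn : m + 1 + 3 * (k - 1) ≤ n) (D : ℕ) :
    ∃ h : ℕ, D * h ≤ k * bergeSat k n (SimpleGraph.completeGraph (Fin (m + 2))) ∧
      m * n ≤ (k - 1) * bergeSat k n (SimpleGraph.completeGraph (Fin (m + 2))) +
        m * (h + k * (1 + D * k + D * k * (D * k))) := by
  classical
  -- The infimum defining `bergeSat` is attained since saturated hypergraphs exist.
  obtain ⟨H₀, hV₀, hH₀, -⟩ := exists_saturated_fin hk hn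
  obtain ⟨H, hV, ⟨hunif, hfree, hadd⟩, hcard⟩ := Nat.sInf_mem
    (s := {c : ℕ | ∃ H : Hypergraph (Fin n), H.vertexSet = Set.univ ∧
      IsBergeSaturated (SimpleGraph.completeGraph (Fin (m + 2))) k H ∧ H.edgeSet.ncard = c})
    ⟨_, H₀, hV₀, hH₀, rfl⟩
  change _ = bergeSat k n (SimpleGraph.completeGraph (Fin (m + 2))) at hcard
  rw [containsBerge_completeGraph_iff hV] at hfree
  have hE : H.edgeSet.toFinset.card = bergeSat k n (SimpleGraph.completeGraph (Fin (m + 2))) := by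
    rw [← hcard, Set.ncard_eq_toFinset_card']
  have key := card_mul_le_of_saturated H.edgeSet.toFinset k m (by omega) (fun e he => by
    have := hunif e (Set.mem_toFinset.1 he)
    rw [← (Set.toFinite e).cast_ncard_eq] at this
    exact_mod_cast this) (fun e hek heE => by
    have heE' : e ∉ H.edgeSet := fun h => heE (Set.mem_toFinset.2 h)
    have he : e ⊆ H.vertexSet := by rw [hV]; exact Set.subset_univ _
    have h := hadd e he (by rw [← (Set.toFinite e).cast_ncard_eq, hek]) heE'
    rw [containsBerge_completeGraph_iff (by exact hV)] at h
    simpa only [Set.mem_toFinset] using exists_common_neighbours hfree h) D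
  rwa [hE, Fintype.card_fin] at key

end Hypergraph

theorem theorem1p2 (ℓ k : ℕ) (hℓ : 3 ≤ ℓ) (hk : 3 ≤ k) :
    Asymptotics.IsEquivalent Filter.atTop
      (fun n : ℕ => (Hypergraph.bergeSat k n (SimpleGraph.completeGraph (Fin ℓ)) : ℝ))
      (fun n : ℕ => ((ℓ : ℝ) - 2) / ((k : ℝ) - 1) * (n : ℝ)) := by
  obtain ⟨m, rfl⟩ : ∃ m, ℓ = m + 2 := ⟨ℓ - 2, by omega⟩
  have hm : (0 : ℝ) < m := by exact_mod_cast (by omega : 0 < m)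
  have hk1 : (0 : ℝ) < (k : ℝ) - 1 := by
    have : (3 : ℝ) ≤ k := by exact_mod_cast hk
    linarith
  have hc0 : (((m + 2 : ℕ) : ℝ) - 2) / ((k : ℝ) - 1) = m / ((k : ℝ) - 1) := by
    push_cast; ring
  rw [hc0]
  obtain ⟨C, hC⟩ := Hypergraph.bergeSat_le (m := m) hk
  set c : ℝ := m / ((k : ℝ) - 1) with hc
  have hcpos : 0 < c := div_pos hm hk1
  refine Asymptotics.isLittleO_iff.2 fun ε hε => ?_
  -- With degree threshold `D ≥ 2 k c / ε`, the high vertices contribute at most `ε c n / 2`.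
  obtain ⟨D, hD⟩ := exists_nat_gt (max 1 (2 * k * c / ε))
  have hD1 : (1 : ℝ) < D := (le_max_left _ _).trans_lt hD
  have hDε : k * c ≤ ε / 2 * D := by
    have := (le_max_right _ _).trans_lt hD
    rw [div_lt_iff₀ hε] at this
    linarith
  let M : ℝ := ((k * (1 + D * k + D * k * (D * k)) : ℕ) : ℝ)
  filter_upwards [Filter.eventually_ge_atTop (m + 1 + 3 * (k - 1)),
    tendsto_natCast_atTop_atTop.eventually_ge_atTop (C / (ε * c)),
    tendsto_natCast_atTop_atTop.eventually_ge_atTop ((k * |C| + M) / (ε / 2))]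
    with n hn hnC hnM
  rw [div_le_iff₀ (by positivity)] at hnC hnM
  have hup := hC n hn
  obtain ⟨h, hh, hlow⟩ := Hypergraph.le_bergeSat (m := m) hk hn D
  set s : ℕ := Hypergraph.bergeSat k n (SimpleGraph.completeGraph (Fin (m + 2))) with hs
  have hn0 : (0 : ℝ) ≤ n := Nat.cast_nonneg n
  have hk0 : (0 : ℝ) ≤ k := Nat.cast_nonneg k
  simp only [Pi.sub_apply, Real.norm_eq_abs]
  rw [abs_of_nonneg (by positivity : (0 : ℝ) ≤ c * n), abs_le]
  have hlow' : c * n ≤ s + c * (h + M) := by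
    have h1 : (m : ℝ) * n ≤ ((k : ℝ) - 1) * s + m * (h + M) := by
      have h2 : ((m * n : ℕ) : ℝ) ≤ (((k - 1) * s +
        m * (h + k * (1 + D * k + D * k * (D * k))) : ℕ) : ℝ) := Nat.cast_le.2 hlow
      rw [Nat.cast_mul, Nat.cast_add, Nat.cast_mul, Nat.cast_mul, Nat.cast_add,
        Nat.cast_sub (by omega : 1 ≤ k), Nat.cast_one] at h2
      exact h2
    calc c * n = (m * n) / ((k : ℝ) - 1) := by rw [hc]; ring
      _ ≤ (((k : ℝ) - 1) * s + m * (h + M)) / ((k : ℝ) - 1) := by gcongr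
      _ = _ := by rw [hc]; field_simp
  have hh' : (h : ℝ) ≤ ε / 2 * n + k * |C| := by
    have h1 : (D : ℝ) * h ≤ k * s := by exact_mod_cast hh
    have h2 : (k : ℝ) * s ≤ k * (c * n + |C|) := by
      gcongr
      exact hup.trans (by gcongr; exact le_abs_self C)
    have h3 : k * c * n ≤ ε / 2 * D * n := by gcongr
    have h4 : (k : ℝ) * |C| ≤ D * (k * |C|) :=
      le_mul_of_one_le_left (by positivity) hD1.le
    refine le_of_mul_le_mul_left (a := (D : ℝ)) ?_ (by linarith)
    calc (D : ℝ) * h ≤ k * c * n + k * |C| := by linarith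
      _ ≤ ε / 2 * D * n + D * (k * |C|) := add_le_add h3 h4
      _ = _ := by ring
  constructor
  · have : c * (h + M) ≤ c * (ε * n) := by
      gcongr
      linarith
    linarith
  · linarith
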